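/- Let $G=(V,E)$ be a connected finite simple graph with $n=|V|$ vertices, and fix a linear order of its edges. For $T\subseteq E$ let $B_1,\dots,B_r$ be the vertex sets of the connected components of the spanning subgraph $(V,T)$, and let $b_m=|B_m|$. For a finite set $B$ with $b$ elements let $S^{(b-1,1)}$ be the $\mathbb{C}[S_B]$-module of vectors in $\mathbb{C}^B$ with coordinate sum zero (the zero module if $b=1$), and let $\mathcal{L}_b=\bigwedge^* S^{(b-1,1)}$, graded by exterior degree. Define the graded $\mathbb{C}[S_V]$-module $$\mathcal{M}_T=\mathrm{Ind}_{S_{B_1}\times\dots\times S_{B_r}}^{S_V}\bigl(\mathcal{L}_{b_1}\otimes\dots\otimes\mathcal{L}_{b_r}\bigr),\qquad \mathcal{L}_{b_1}\otimes\dots\otimes\mathcal{L}_{b_r}=\textstyle\bigwedge^*\bigl(S^{(b_1-1,1)}\oplus\dots\oplus S^{(b_r-1,1)}\bigr).$$ For $e\in E\setminus T$ let $d_{T\lessdot T+e}:\mathcal{M}_T\to\mathcal{M}_{T+e}$ be the following degree-preserving $\mathbb{C}[S_V]$-linear map. If $e$ joins two vertices of the same component of $T$, it is the identity. If $e$ joins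 two components, with vertex sets $A$ and $B$ of sizes $a$ and $b$, it is the map that corresponds under Frobenius reciprocity to the inclusion $\mathcal{L}_a\otimes\mathcal{L}_b=\bigwedge^*(S^{(a-1,1)}\oplus S^{(b-1,1)})\hookrightarrow\bigwedge^*S^{(a+b-1,1)}=\mathcal{L}_{a+b}$, tensored with the identity on the other components. These maps define a functor from the Boolean lattice $2^E$ to graded $\mathbb{C}[S_V]$-modules. Let $C^*$ be the cochain complex with $C^i=\bigoplus_{|T|=i}\mathcal{M}_T$ and with differential $\sum_{T\lessdot T+e}(-1)^{\#\{f\in T\,:\,f<e\}}d_{T\lessdot T+e}$. The chromatic symmetric homology $H_{CS}(G)$ is the cohomology of $C^*$; write $H_{CS}^{i,j}(G)$ for the degree $j$ part of $H^i(C^*)$, where $i,j\in\mathbb{Z}$. Then $H_{CS}(G)$ is supported in bidegrees $(i,j)$ with $0\le i\le n-1$ and $0\le j\le i$: if $H_{CS}^{i,j}(G)\neq 0$, then $0\le i\le n-1$ and $0\le j\le i$. -/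

import Mathlib

open CategoryTheory CategoryTheory.Limits

universe u v w

/-! ### The cochain complex of a functor on a Boolean lattice -/

namespace BooleanLattice

variable {E : Type u} [LinearOrder E]

/-- The standard balanced coloring of the cover relations of the lattice of finite subsets of `E`:
if `T = S ∪ {e}` with `e ∉ S`, the sign of `S ⋖ T` is `(-1) ^ #{f ∈ S | f < e}`
(the product below then has exactly one factor). -/
def sign (S T : Finset E) : ℤ :=
  ∏ e ∈ T \ S, (-1) ^ (S.filter (fun f => f < e)).card

lemma sign_insert {S : Finset E} {e : E} (he : e ∉ S) :
    sign S (insert e S) = (-1) ^ (S.filter (fun f => f < e)).card := by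
  have : insert e S \ S = {e} := by
    ext x; simp only [Finset.mem_sdiff, Finset.mem_insert, Finset.mem_singleton]
    constructor
    · rintro ⟨rfl | h, h'⟩
      · rfl
      · exact absurd h h'
    · rintro rfl; exact ⟨Or.inl rfl, he⟩
  rw [sign, this, Finset.prod_singleton]

/-- Every diamond has an odd number of cover relations of sign `-1`. -/
lemma sign_diamond {S : Finset E} {a b : E} (ha : a ∉ S) (hb : b ∉ S) (hab : a ≠ b) :
    sign S (insert a S) * sign (insert a S) (insert b (insert a S)) +
      sign S (insert b S) * sign (insert b S) (insert b (insert a S)) = 0 := by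
  have hb' : b ∉ insert a S := by simp [hb, hab.symm]
  have ha' : a ∉ insert b S := by simp [ha, hab]
  rw [Finset.insert_comm b a S, sign_insert ha, sign_insert hb, sign_insert ha',
    Finset.insert_comm a b S, sign_insert hb']
  rcases lt_or_gt_of_ne hab with h | h
  · rw [Finset.filter_insert, Finset.filter_insert, if_pos h, if_neg h.not_gt,
      Finset.card_insert_of_notMem (by simp [ha])]
    ring
  · rw [Finset.filter_insert, Finset.filter_insert, if_neg h.not_gt, if_pos h,
      Finset.card_insert_of_notMem (by simp [hb])]
    ring

/-- The elements of rank `k` of the Boolean lattice. -/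
abbrev Rank (E : Type u) (k : ℤ) : Type u := {S : Finset E // (S.card : ℤ) = k}

lemma exists_insert {k : ℤ} {S : Rank E k} {T : Rank E (k + 1)} (h : S.1 ≤ T.1) :
    ∃ e, e ∉ S.1 ∧ insert e S.1 = T.1 := by
  have hc : T.1.card = S.1.card + 1 := by have := S.2; have := T.2; omega
  have h1 : (T.1 \ S.1).card = 1 := by rw [Finset.card_sdiff_of_subset h]; omega
  obtain ⟨e, he⟩ := Finset.card_eq_one.1 h1
  refine ⟨e, ?_, ?_⟩
  · have : e ∈ T.1 \ S.1 := by rw [he]; simp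
    exact (Finset.mem_sdiff.1 this).2
  · rw [Finset.insert_eq, ← he, Finset.sdiff_union_of_subset h]

attribute [local instance] Abelian.hasFiniteBiproducts

lemma lift_desc {A : Type v} [Category.{w} A] [Abelian A] {J : Type u} [Fintype J] {f : J → A}
    {X Y : A} (g : ∀ j, X ⟶ f j) (h : ∀ j, f j ⟶ Y) :
    biproduct.lift g ≫ biproduct.desc h = ∑ j, g j ≫ h j := by
  rw [← Category.comp_id (biproduct.lift g), ← IsBilimit.total (biproduct.isBilimit f),
    Preadditive.comp_sum, Preadditive.sum_comp]
  refine Finset.sum_congr rfl fun j _ => ?_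
  simp

variable [Finite E] {A : Type v} [Category.{w} A] [Abelian A] (F : Finset E ⥤ A)

/-- The cochain object `C^k(F) = ⨁_{|S| = k} F(S)`. -/
noncomputable abbrev cochain (k : ℤ) : A := ⨁ fun S : Rank E k => F.obj S.1

/-- The matrix entries of the differential: `sign S T • F(S ⋖ T)` if `S ⊆ T`, and zero otherwise.
Here `T` has one element more than `S`, so `S ⊆ T` means that `T` covers `S`. -/
noncomputable def entry (k l : ℤ) (S : Rank E k) (T : Rank E l) : F.obj S.1 ⟶ F.obj T.1 :=
  open scoped Classical in
  if h : S.1 ≤ T.1 then sign S.1 T.1 • F.map (homOfLE h) else 0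

/-- The differential `δ^k : C^k(F) ⟶ C^{k+1}(F)`. -/
noncomputable def differential (k : ℤ) : cochain F k ⟶ cochain F (k + 1) :=
  biproduct.desc fun S => biproduct.lift fun T => entry F k (k + 1) S T

lemma differential_comp (k : ℤ) : differential F k ≫ differential F (k + 1) = 0 := by
  classical
  have := Fintype.ofFinite (Rank E (k + 1))
  refine biproduct.hom_ext' _ _ fun S => biproduct.hom_ext _ _ fun U => ?_
  simp only [differential, biproduct.ι_desc_assoc, Category.assoc, comp_zero, zero_comp]
  rw [← Category.assoc, lift_desc, Preadditive.sum_comp]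
  simp only [Category.assoc, biproduct.lift_π]
  by_cases hSU : S.1 ≤ U.1
  swap
  · refine Finset.sum_eq_zero fun T _ => ?_
    unfold entry
    by_cases h1 : S.1 ≤ T.1
    · rw [dif_neg (c := T.1 ≤ U.1) (fun h2 => hSU (h1.trans h2)), comp_zero]
    · rw [dif_neg h1, zero_comp]
  have hcard : ∀ T : Rank E (k + 1), S.1 ≤ T.1 → T.1 ≤ U.1 →
      ∃ a b, a ∉ S.1 ∧ b ∉ S.1 ∧ a ≠ b ∧ insert a S.1 = T.1 ∧ insert b (insert a S.1) = U.1 := by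
    intro T h1 h2
    obtain ⟨a, ha, haT⟩ := exists_insert h1
    obtain ⟨b, hb, hbU⟩ := exists_insert h2
    rw [← haT] at hb hbU
    exact ⟨a, b, ha, fun h => hb (Finset.mem_insert_of_mem h),
      fun h => hb (h ▸ Finset.mem_insert_self a _), haT, hbU⟩
  have hterm : ∀ T : Rank E (k + 1), ∀ (h1 : S.1 ≤ T.1) (h2 : T.1 ≤ U.1),
      entry F k (k + 1) S T ≫ entry F (k + 1) (k + 1 + 1) T U =
        (sign S.1 T.1 * sign T.1 U.1) • F.map (homOfLE hSU) := by
    intro T h1 h2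
    unfold entry
    rw [dif_pos h1, dif_pos h2, Preadditive.zsmul_comp, Preadditive.comp_zsmul, ← F.map_comp,
      smul_smul]
    rfl
  have hterm0 : ∀ T : Rank E (k + 1), ¬ (S.1 ≤ T.1 ∧ T.1 ≤ U.1) →
      entry F k (k + 1) S T ≫ entry F (k + 1) (k + 1 + 1) T U = 0 := by
    intro T h
    unfold entry
    by_cases h1 : S.1 ≤ T.1
    · rw [dif_neg (c := T.1 ≤ U.1) (fun h2 => h ⟨h1, h2⟩), comp_zero]
    · rw [dif_neg h1, zero_comp]
  by_cases hne : ∃ T : Rank E (k + 1), S.1 ≤ T.1 ∧ T.1 ≤ U.1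
  swap
  · exact Finset.sum_eq_zero fun T _ => hterm0 T fun h => hne ⟨T, h⟩
  obtain ⟨T, h1, h2⟩ := hne
  obtain ⟨a, b, ha, hb, hab, haT, hbU⟩ := hcard T h1 h2
  have hSc := S.2
  let T' : Rank E (k + 1) :=
    ⟨insert b S.1, by rw [Finset.card_insert_of_notMem hb]; push_cast; omega⟩
  have hTT' : T ≠ T' := by
    intro h
    have h3 : insert a S.1 = insert b S.1 := haT.trans (congrArg Subtype.val h)
    have h4 : a ∈ insert b S.1 := h3 ▸ Finset.mem_insert_self a _
    simp [ha, hab] at h4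
  have h1' : S.1 ≤ T'.1 := Finset.subset_insert _ _
  have h2' : T'.1 ≤ U.1 := by
    rw [← hbU]; exact Finset.insert_subset_insert _ (Finset.subset_insert _ _)
  have hcoef : sign S.1 T.1 * sign T.1 U.1 + sign S.1 T'.1 * sign T'.1 U.1 = 0 := by
    rw [← hbU, ← haT]
    exact sign_diamond ha hb hab
  rw [← Finset.sum_subset (Finset.subset_univ {T, T'}), Finset.sum_pair hTT', hterm T h1 h2,
    hterm T' h1' h2', ← add_smul, hcoef, zero_smul]
  · intro R _ hR
    refine hterm0 R fun h => hR ?_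
    obtain ⟨e, he, heR⟩ := exists_insert h.1
    have : e ∈ U.1 := h.2 (heR ▸ Finset.mem_insert_self e _)
    rw [← hbU, Finset.mem_insert, Finset.mem_insert] at this
    rw [Finset.mem_insert, Finset.mem_singleton]
    rcases this with rfl | rfl | h
    · right; exact Subtype.ext heR.symm
    · left; exact Subtype.ext (heR.symm.trans haT)
    · exact absurd h he

/-- The cochain complex `C^*(F)` of a functor `F` on the Boolean lattice of subsets of `E`. -/
noncomputable def complex : CochainComplex A ℤ :=
  CochainComplex.of (cochain F) (differential F) (differential_comp F)

end BooleanLattice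

/-! ### Exterior powers of a representation, graded by the integers -/

namespace ChromaticSymmetric

section Exterior

variable {U U' U'' : Type u} [AddCommGroup U] [Module ℂ U] [AddCommGroup U'] [Module ℂ U']
  [AddCommGroup U''] [Module ℂ U'']

/-- The degree `j` part of the exterior algebra of `U`, for an integer `j`. -/
noncomputable def extPart (U : Type u) [AddCommGroup U] [Module ℂ U] (j : ℤ) :
    Submodule ℂ (ExteriorAlgebra ℂ U) :=
  if 0 ≤ j then ⋀[ℂ]^j.toNat U else ⊥

lemma map_mem_extPart (f : U →ₗ[ℂ] U') (j : ℤ) :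
    ∀ x ∈ extPart U j, (ExteriorAlgebra.map f).toLinearMap x ∈ extPart U' j := by
  intro x hx
  unfold extPart at hx ⊢
  split_ifs at hx ⊢ with h
  · have h1 : (LinearMap.range (ExteriorAlgebra.ι ℂ (M := U))).map
        (ExteriorAlgebra.map f).toLinearMap ≤ LinearMap.range (ExteriorAlgebra.ι ℂ (M := U')) := by
      rintro _ ⟨_, ⟨y, rfl⟩, rfl⟩
      exact ⟨f y, by simp⟩
    have h2 := Submodule.mem_map_of_mem (f := (ExteriorAlgebra.map f).toLinearMap) hx
    rw [Submodule.map_pow] at h2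
    exact pow_le_pow_left' h1 _ h2
  · rw [Submodule.mem_bot] at hx ⊢
    rw [hx, map_zero]

/-- The map that a linear map `f` induces on the degree `j` parts of the exterior algebras. -/
noncomputable def extMap (f : U →ₗ[ℂ] U') (j : ℤ) : extPart U j →ₗ[ℂ] extPart U' j :=
  (ExteriorAlgebra.map f).toLinearMap.restrict (map_mem_extPart f j)

lemma extMap_id (j : ℤ) : extMap (LinearMap.id : U →ₗ[ℂ] U) j = LinearMap.id := by
  ext x; simp [extMap]

lemma extMap_comp (g : U' →ₗ[ℂ] U'') (f : U →ₗ[ℂ] U') (j : ℤ) :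
    extMap (g ∘ₗ f) j = extMap g j ∘ₗ extMap f j := by
  ext x
  simp only [extMap, LinearMap.coe_restrict_apply, LinearMap.comp_apply, AlgHom.toLinearMap_apply]
  rw [← ExteriorAlgebra.map_comp_map]; rfl

lemma extMap_inclusion_refl (p : Submodule ℂ U) (j : ℤ) :
    extMap (Submodule.inclusion (le_refl p)) j = LinearMap.id := by
  have : Submodule.inclusion (le_refl p) = LinearMap.id := LinearMap.ext fun _ => rfl
  rw [this, extMap_id]

lemma extMap_inclusion_trans {p q r : Submodule ℂ U} (h : p ≤ q) (h' : q ≤ r) (j : ℤ) :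
    extMap (Submodule.inclusion (h.trans h')) j =
      extMap (Submodule.inclusion h') j ∘ₗ extMap (Submodule.inclusion h) j := by
  rw [← extMap_comp]; rfl

lemma extMap_inclusion_restrict {p q : Submodule ℂ U} (h : p ≤ q) (f : U →ₗ[ℂ] U)
    (hp : ∀ x ∈ p, f x ∈ p) (hq : ∀ x ∈ q, f x ∈ q) (j : ℤ) (x : extPart p j) :
    extMap (Submodule.inclusion h) j (extMap (f.restrict hp) j x) =
      extMap (f.restrict hq) j (extMap (Submodule.inclusion h) j x) := by
  rw [← LinearMap.comp_apply, ← LinearMap.comp_apply, ← extMap_comp, ← extMap_comp]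
  rfl

/-- The degree `j` part of the exterior algebra of a representation. -/
noncomputable def extRep {Γ : Type u} [Group Γ] (ρ : Representation ℂ Γ U) (j : ℤ) :
    Representation ℂ Γ (extPart U j) where
  toFun g := extMap (ρ g) j
  map_one' := by rw [map_one]; exact extMap_id j
  map_mul' g h := by rw [map_mul]; exact extMap_comp _ _ j

end Exterior

/-! ### Induction along a chain of subgroups -/

section Induction

open scoped MonoidAlgebra

variable {H : Type u} [Group H] {Y Y' Y'' : Subgroup H}
  {L L' L'' : Type u} [AddCommGroup L] [Module ℂ L] [AddCommGroup L'] [Module ℂ L']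
  [AddCommGroup L''] [Module ℂ L'']
  (ρ : Representation ℂ Y L) (ρ' : Representation ℂ Y' L') (ρ'' : Representation ℂ Y'' L'')

/-- For subgroups `Y ≤ Y'` of `H` and a `Y`-equivariant map `f : L → L'` from a representation of
`Y` to a representation of `Y'`, the linear map `Ind_Y^H L → Ind_{Y'}^H L'`,
`h ⊗ x ↦ h ⊗ f x`. -/
noncomputable def indLinearMap (hY : Y ≤ Y') (f : L →ₗ[ℂ] L')
    (hf : ∀ (y : Y) (x : L), f (ρ y x) = ρ' (Subgroup.inclusion hY y) (f x)) :
    Representation.IndV Y.subtype ρ →ₗ[ℂ] Representation.IndV Y'.subtype ρ' :=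
  Representation.Coinvariants.lift _
    (Representation.Coinvariants.mk _ ∘ₗ f.lTensor ℂ[H]) (by
      intro y
      ext h x
      have := Representation.Coinvariants.mk_self_apply
        (Representation.tprod ((Representation.leftRegular ℂ H).comp Y'.subtype) ρ')
        (Subgroup.inclusion hY y) ((MonoidAlgebra.single h 1) ⊗ₜ[ℂ] f x)
      simpa [hf] using this)

lemma indLinearMap_mk (hY : Y ≤ Y') (f : L →ₗ[ℂ] L')
    (hf : ∀ (y : Y) (x : L), f (ρ y x) = ρ' (Subgroup.inclusion hY y) (f x)) (h : H) (x : L) :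
    indLinearMap ρ ρ' hY f hf (Representation.IndV.mk Y.subtype ρ h x) =
      Representation.IndV.mk Y'.subtype ρ' h (f x) := rfl

/-- The map `indLinearMap` as a morphism of representations of `H`. It corresponds to `f` under
Frobenius reciprocity. -/
noncomputable def indHom (hY : Y ≤ Y') (f : L →ₗ[ℂ] L')
    (hf : ∀ (y : Y) (x : L), f (ρ y x) = ρ' (Subgroup.inclusion hY y) (f x)) :
    Rep.of (ρ.ind Y.subtype) ⟶ Rep.of (ρ'.ind Y'.subtype) :=
  Rep.ofHom ⟨indLinearMap ρ ρ' hY f hf, by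
    intro g
    refine Representation.IndV.hom_ext _ _ fun h => LinearMap.ext fun x => ?_
    change indLinearMap ρ ρ' hY f hf
        (ρ.ind Y.subtype g (Representation.IndV.mk Y.subtype ρ h x)) =
      ρ'.ind Y'.subtype g (Representation.IndV.mk Y'.subtype ρ' h (f x))
    rw [Representation.ind_mk, Representation.ind_mk, indLinearMap_mk]⟩

lemma indHom_id (hY : Y ≤ Y) (f : L →ₗ[ℂ] L)
    (hf : ∀ (y : Y) (x : L), f (ρ y x) = ρ (Subgroup.inclusion hY y) (f x))
    (h : f = LinearMap.id) : indHom ρ ρ hY f hf = 𝟙 _ := by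
  subst h
  refine Rep.hom_ext (Representation.IntertwiningMap.toLinearMap_injective _ _ ?_)
  exact Representation.IndV.hom_ext _ _ fun h => LinearMap.ext fun x => rfl

lemma indHom_comp (hY : Y ≤ Y') (hY' : Y' ≤ Y'') (hY'' : Y ≤ Y'') (f : L →ₗ[ℂ] L')
    (f' : L' →ₗ[ℂ] L'') (f'' : L →ₗ[ℂ] L'')
    (hf : ∀ (y : Y) (x : L), f (ρ y x) = ρ' (Subgroup.inclusion hY y) (f x))
    (hf' : ∀ (y : Y') (x : L'), f' (ρ' y x) = ρ'' (Subgroup.inclusion hY' y) (f' x))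
    (hf'' : ∀ (y : Y) (x : L), f'' (ρ y x) = ρ'' (Subgroup.inclusion hY'' y) (f'' x))
    (h : f'' = f' ∘ₗ f) :
    indHom ρ ρ'' hY'' f'' hf'' = indHom ρ ρ' hY f hf ≫ indHom ρ' ρ'' hY' f' hf' := by
  subst h
  refine Rep.hom_ext (Representation.IntertwiningMap.toLinearMap_injective _ _ ?_)
  exact Representation.IndV.hom_ext _ _ fun h => LinearMap.ext fun x => rfl

end Induction

/-! ### Chromatic symmetric homology -/

section Graph

variable {V : Type u}

/-- The permutation action of the symmetric group `S_V` on `ℂ^V`: `(σ x)(v) = x (σ⁻¹ v)`. -/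
def permRep (V : Type u) : Representation ℂ (Equiv.Perm V) (V → ℂ) where
  toFun σ := LinearMap.funLeft ℂ ℂ (σ⁻¹ : Equiv.Perm V)
  map_one' := rfl
  map_mul' σ τ := by rw [mul_inv_rev]; rfl

/-- The irreducible representation `S^{(b-1,1)}` of `S_B`, where `b = |B|`, realized as the space
of vectors in `ℂ^B` with coordinate sum zero (the zero space if `b = 1`). Vectors in `ℂ^B` are
extended by zero to `V`. -/
def std [Fintype V] (B : Set V) : Submodule ℂ (V → ℂ) where
  carrier := {x | (∀ v, v ∉ B → x v = 0) ∧ ∑ v, x v = 0}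
  zero_mem' := by simp
  add_mem' := by
    rintro x y ⟨hx, hx'⟩ ⟨hy, hy'⟩
    exact ⟨fun v hv => by simp [hx v hv, hy v hv], by simp [Finset.sum_add_distrib, hx', hy']⟩
  smul_mem' := by
    rintro c x ⟨hx, hx'⟩
    exact ⟨fun v hv => by simp [hx v hv], by simp [← Finset.mul_sum, hx']⟩

variable (G : SimpleGraph V)

/-- The spanning subgraph of `G` with edge set `T`. -/
def spanning (T : Finset G.edgeSet) : SimpleGraph V :=
  SimpleGraph.fromEdgeSet (Subtype.val '' (T : Set G.edgeSet))

lemma spanning_mono {T T' : Finset G.edgeSet} (h : T ≤ T') : spanning G T ≤ spanning G T' :=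
  SimpleGraph.fromEdgeSet_mono (Set.image_mono (Finset.coe_subset.2 h))

/-- The Young subgroup `S_{B_1} × ⋯ × S_{B_r}` of `S_V`, where `B_1, …, B_r` are the vertex sets of
the connected components of the spanning subgraph `T`: the permutations of `V` that map each
`B_i` to itself. -/
def young (T : Finset G.edgeSet) : Subgroup (Equiv.Perm V) where
  carrier := {σ | ∀ v, (spanning G T).connectedComponentMk (σ v) =
    (spanning G T).connectedComponentMk v}
  one_mem' _ := rfl
  mul_mem' {σ τ} hσ hτ v := (hσ (τ v)).trans (hτ v)
  inv_mem' {σ} hσ v := by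
    have h := hσ (σ.symm v)
    rw [Equiv.apply_symm_apply] at h
    exact h.symm

lemma young_mono {T T' : Finset G.edgeSet} (h : T ≤ T') : young G T ≤ young G T' := by
  intro σ hσ v
  have := hσ v
  rw [SimpleGraph.ConnectedComponent.eq] at this ⊢
  exact this.mono (spanning_mono G h)

variable [Fintype V]

/-- The direct sum `S^{(b_1-1,1)} ⊕ ⋯ ⊕ S^{(b_r-1,1)}` over the connected components `B_1, …, B_r`
of the spanning subgraph `T`, as an (internal) sum in `ℂ^V`. -/
def stdSum (T : Finset G.edgeSet) : Submodule ℂ (V → ℂ) :=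
  ⨆ C : (spanning G T).ConnectedComponent, std C.supp

lemma stdSum_mono {T T' : Finset G.edgeSet} (h : T ≤ T') : stdSum G T ≤ stdSum G T' := by
  refine iSup_le fun C => ?_
  refine le_trans ?_ (le_iSup _ (C.map (SimpleGraph.Hom.ofLE (spanning_mono G h))))
  rintro x ⟨hx, hx'⟩
  refine ⟨fun v hv => hx v fun hvC => hv ?_, hx'⟩
  rw [SimpleGraph.ConnectedComponent.mem_supp_iff] at hvC ⊢
  rw [← hvC]; rfl

lemma permRep_mem_stdSum (T : Finset G.edgeSet) (σ : young G T) :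
    ∀ x ∈ stdSum G T, permRep V σ.1 x ∈ stdSum G T := by
  suffices stdSum G T ≤ (stdSum G T).comap (permRep V σ.1) from this
  refine iSup_le fun C => ?_
  rintro x ⟨hx, hx'⟩
  refine Submodule.mem_iSup_of_mem C ⟨fun v hv => hx _ fun h => hv ?_, ?_⟩
  · rw [SimpleGraph.ConnectedComponent.mem_supp_iff] at h ⊢
    rw [← h]
    exact ((inv_mem σ.2 : σ.1⁻¹ ∈ young G T) v).symm
  · rw [← hx']
    exact Equiv.sum_comp (σ.1⁻¹ : Equiv.Perm V) x

/-- The action of the Young subgroup on `S^{(b_1-1,1)} ⊕ ⋯ ⊕ S^{(b_r-1,1)}`. -/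
def stdSumRep (T : Finset G.edgeSet) : Representation ℂ (young G T) (stdSum G T) where
  toFun σ := (permRep V σ.1).restrict (permRep_mem_stdSum G T σ)
  map_one' := rfl
  map_mul' _ _ := rfl

/-- The degree `j` part of the graded representation `L_{b_1} ⊗ ⋯ ⊗ L_{b_r}` of the Young subgroup,
where `L_b = ⋀^* S^{(b-1,1)}`. The tensor product of these exterior algebras is
`⋀^* (S^{(b_1-1,1)} ⊕ ⋯ ⊕ S^{(b_r-1,1)})`. -/
noncomputable def tensorRep (T : Finset G.edgeSet) (j : ℤ) :
    Representation ℂ (young G T) (extPart (stdSum G T) j) :=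
  extRep (stdSumRep G T) j

/-- The map from the tensor product for `T` to the one for a larger set `T'` that is induced by the
inclusion of direct sums. If two components `A` and `B` are joined into one, this is the inclusion
of `L_a ⊗ L_b = ⋀^* (S^{(a-1,1)} ⊕ S^{(b-1,1)})` into `L_{a+b} = ⋀^* S^{(a+b-1,1)}`; it is the
identity if `T` and `T'` have the same components. -/
noncomputable def tensorMap {T T' : Finset G.edgeSet} (h : T ≤ T') (j : ℤ) :
    extPart (stdSum G T) j →ₗ[ℂ] extPart (stdSum G T') j :=
  extMap (Submodule.inclusion (stdSum_mono G h)) j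

lemma tensorMap_eq {T T' : Finset G.edgeSet} (h : T ≤ T') (j : ℤ) :
    tensorMap G h j = extMap (Submodule.inclusion (stdSum_mono G h)) j := rfl

lemma tensorMap_id (T : Finset G.edgeSet) (j : ℤ) :
    tensorMap G (le_refl T) j = LinearMap.id :=
  (tensorMap_eq G (le_refl T) j).trans (extMap_inclusion_refl _ j)

lemma tensorMap_comp {T T' T'' : Finset G.edgeSet} (h : T ≤ T') (h' : T' ≤ T'') (j : ℤ) :
    tensorMap G (h.trans h') j = tensorMap G h' j ∘ₗ tensorMap G h j := by
  rw [tensorMap_eq, tensorMap_eq, tensorMap_eq]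
  exact extMap_inclusion_trans (stdSum_mono G h) (stdSum_mono G h') j

lemma tensorMap_equivariant {T T' : Finset G.edgeSet} (h : T ≤ T') (j : ℤ) (σ : young G T)
    (x : extPart (stdSum G T) j) :
    tensorMap G h j (tensorRep G T j σ x) =
      tensorRep G T' j (Subgroup.inclusion (young_mono G h) σ) (tensorMap G h j x) := by
  rw [tensorMap_eq]
  exact extMap_inclusion_restrict (stdSum_mono G h) (permRep V σ.1) (permRep_mem_stdSum G T σ)
    (permRep_mem_stdSum G T' (Subgroup.inclusion (young_mono G h) σ)) j x

/-- The degree `j` part of `M_T = Ind_{S_{B_1} × ⋯ × S_{B_r}}^{S_V} (L_{b_1} ⊗ ⋯ ⊗ L_{b_r})`. -/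
noncomputable def M (T : Finset G.edgeSet) (j : ℤ) : Rep.{u} ℂ (Equiv.Perm V) :=
  Rep.of ((tensorRep G T j).ind (young G T).subtype)

/-- The map `M_T → M_{T'}` in degree `j`, induced by `tensorMap` and the inclusion of Young
subgroups. -/
noncomputable def MMap {T T' : Finset G.edgeSet} (h : T ≤ T') (j : ℤ) : M G T j ⟶ M G T' j :=
  indHom (tensorRep G T j) (tensorRep G T' j) (young_mono G h) (tensorMap G h j)
    (tensorMap_equivariant G h j)

lemma MMap_id (T : Finset G.edgeSet) (j : ℤ) : MMap G (le_refl T) j = 𝟙 (M G T j) :=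
  indHom_id _ _ _ _ (tensorMap_id G T j)

lemma MMap_comp {T T' T'' : Finset G.edgeSet} (h : T ≤ T') (h' : T' ≤ T'') (j : ℤ) :
    MMap G (h.trans h') j = MMap G h j ≫ MMap G h' j :=
  indHom_comp (tensorRep G T j) (tensorRep G T' j) (tensorRep G T'' j) _ _ _ _ _ _ _ _ _
    (tensorMap_comp G h h' j)

/-- The chromatic symmetric functor from the Boolean lattice of sets of edges of `G` to graded
representations of the symmetric group `S_V`. -/
noncomputable def functor :
    Finset G.edgeSet ⥤ GradedObject ℤ (Rep.{u} ℂ (Equiv.Perm V)) where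
  obj T := fun j => M G T j
  map h := fun j => MMap G (leOfHom h) j
  map_id T := funext fun j => MMap_id G T j
  map_comp h h' := funext fun j => MMap_comp G (leOfHom h) (leOfHom h') j

/-- The chromatic symmetric homology of `G` in bidegree `(i, j)`: the degree `j` part of the `i`-th
cohomology of the cochain complex of the chromatic symmetric functor, for a fixed linear order of
the edges of `G`. -/
noncomputable def HCS [LinearOrder G.edgeSet] (i j : ℤ) : Rep.{u} ℂ (Equiv.Perm V) :=
  (BooleanLattice.complex (functor G ⋙ GradedObject.eval j)).homology i

end Graph

end ChromaticSymmetric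

/-!
The vanishing has two sources.

*Dimension.* The module `S^{(b_1-1,1)} ⊕ ⋯ ⊕ S^{(b_r-1,1)}` attached to a set of edges `T` is the
span in `ℂ^V` of the edge vectors `δ_u - δ_v` with `uv ∈ T` (`stdSum_eq_edgeSpan`). So its dimension
is at most `#T`, and its exterior powers of degree `j > #T` vanish. Hence the cochain objects are
zero in bidegrees `(i, j)` with `i < 0`, `j < 0` or `j > i`.

*Broken circuits.* Call an edge `e` active for `T` if its edge vector lies in the span of the edge
vectors of the edges of `T` below `e`. For such an `e` the sets `T` and `T ∪ {e}` have the same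
connected components, so the structure map between their modules is an isomorphism. If `#T ≥ #V`, the
edge vectors of `T` are linearly dependent, and the largest edge in a linear relation is active for
`T` (`exists_isActive`). The summands for which some edge is active can be cancelled in pairs, as
follows. For an edge `e`, let `h` be the map of degree `-1` that inverts the structure maps
`T ⋖ T ∪ {e}` for which `e` is active, and let `φ_e = 1 - (δ h + h δ)`, which induces the identity on
cohomology. Then `φ_e` is zero on the summands for which `e` is active (`inj_sweep_proj_eq_zero`), and
an edge below `e` that is active for a summand remains active for all summands in its image
(`inj_sweep_proj_eq_zero_of_active_lt`). The composite of all `φ_e`, the one of the largest edge being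
applied first, is therefore zero in every degree `i` for which all sets of `i` edges have an active
edge, and so the cohomology vanishes there (`isZero_homology_complex`).
-/

/-! ### Cancellation in the cochain complex of a functor on a Boolean lattice -/

namespace BooleanLattice

section Contraction

attribute [local instance] Abelian.hasFiniteBiproducts

variable {E : Type u} [LinearOrder E] {A : Type v} [Category.{w} A] [Abelian A]
  (F : Finset E ⥤ A) (act : E → Finset E → Prop)

lemma sign_mul_self (S T : Finset E) : sign S T * sign S T = 1 := by
  rw [sign, ← Finset.prod_mul_distrib]
  exact Finset.prod_eq_one fun e _ => by rw [← mul_pow]; simp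

/-- The matrix entries of the partial contracting homotopy attached to `e`: if `S = T ∪ {e}` with
`e ∉ T`, if `e` is active for `T` and if `F(T ⋖ S)` is invertible, the entry from `S` to `T` is the
inverse of the corresponding entry of the differential; all other entries are zero. -/
noncomputable def contractionEntry (e : E) (S T : Finset E) : F.obj S ⟶ F.obj T :=
  open scoped Classical in
  if h : ∃ hTS : T ≤ S, e ∉ T ∧ insert e T = S ∧ act e T ∧ IsIso (F.map (homOfLE hTS)) then
    haveI := h.2.2.2.2
    sign T S • inv (F.map (homOfLE h.1))
  else 0

lemma contractionEntry_eq_zero {e : E} {S T : Finset E}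
    (h : ¬ (e ∉ T ∧ insert e T = S ∧ act e T)) : contractionEntry F act e S T = 0 :=
  dif_neg fun h' => h ⟨h'.2.1, h'.2.2.1, h'.2.2.2.1⟩

lemma contractionEntry_eq {e : E} {S T : Finset E} (hTS : T ≤ S) (he : e ∉ T)
    (hS : insert e T = S) (ha : act e T) [IsIso (F.map (homOfLE hTS))] :
    contractionEntry F act e S T = sign T S • inv (F.map (homOfLE hTS)) :=
  dif_pos ⟨hTS, he, hS, ha, inferInstance⟩

lemma entry_eq_zero {k l : ℤ} {S : Rank E k} {T : Rank E l} (h : ¬ S.1 ≤ T.1) :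
    entry F k l S T = 0 := dif_neg h

lemma entry_eq {k l : ℤ} {S : Rank E k} {T : Rank E l} (h : S.1 ≤ T.1) :
    entry F k l S T = sign S.1 T.1 • F.map (homOfLE h) := dif_pos h

lemma entry_comp_contractionEntry_self {e : E} {k l : ℤ} {S : Rank E k} {U : Rank E l}
    (he : e ∉ S.1) (hU : insert e S.1 = U.1) (ha : act e S.1)
    (hiso : ∀ h : S.1 ≤ U.1, IsIso (F.map (homOfLE h))) :
    entry F k l S U ≫ contractionEntry F act e U.1 S.1 = 𝟙 _ := by
  have h : S.1 ≤ U.1 := hU ▸ Finset.subset_insert _ _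
  have := hiso h
  rw [entry_eq F h, contractionEntry_eq F act h he hU ha, Preadditive.zsmul_comp,
    Preadditive.comp_zsmul, smul_smul, sign_mul_self, one_smul, IsIso.hom_inv_id]

lemma contractionEntry_comp_entry_self {e : E} {k l : ℤ} {S : Rank E k} {U : Rank E l}
    (he : e ∉ S.1) (hU : insert e S.1 = U.1) (ha : act e S.1)
    (hiso : ∀ h : S.1 ≤ U.1, IsIso (F.map (homOfLE h))) :
    contractionEntry F act e U.1 S.1 ≫ entry F k l S U = 𝟙 _ := by
  have h : S.1 ≤ U.1 := hU ▸ Finset.subset_insert _ _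
  have := hiso h
  rw [entry_eq F h, contractionEntry_eq F act h he hU ha, Preadditive.zsmul_comp,
    Preadditive.comp_zsmul, smul_smul, sign_mul_self, one_smul, IsIso.inv_hom_id]

variable [Finite E]

/-- The inclusion of `F(S)` into the term of degree `#S` of the cochain complex. -/
noncomputable def inj {k : ℤ} (S : Rank E k) : F.obj S.1 ⟶ (complex F).X k :=
  biproduct.ι (fun S : Rank E k => F.obj S.1) S

/-- The projection of the term of degree `#S` of the cochain complex onto `F(S)`. -/
noncomputable def proj {k : ℤ} (S : Rank E k) : (complex F).X k ⟶ F.obj S.1 :=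
  biproduct.π (fun S : Rank E k => F.obj S.1) S

lemma hom_ext_proj {k : ℤ} {Z : A} {f g : Z ⟶ (complex F).X k}
    (h : ∀ S : Rank E k, f ≫ proj F S = g ≫ proj F S) : f = g :=
  biproduct.hom_ext (f := fun S : Rank E k => F.obj S.1) f g h

lemma inj_proj_self {k : ℤ} (S : Rank E k) : inj F S ≫ proj F S = 𝟙 (F.obj S.1) :=
  biproduct.ι_π_self (fun S : Rank E k => F.obj S.1) S

lemma inj_proj_ne {k : ℤ} {S T : Rank E k} (h : S ≠ T) : inj F S ≫ proj F T = 0 :=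
  biproduct.ι_π_ne (fun S : Rank E k => F.obj S.1) h

lemma sum_proj_inj (k : ℤ) [Fintype (Rank E k)] :
    ∑ S : Rank E k, proj F S ≫ inj F S = 𝟙 ((complex F).X k) :=
  IsBilimit.total (biproduct.isBilimit fun S : Rank E k => F.obj S.1)

lemma inj_d_proj {k l : ℤ} (h : k + 1 = l) (S : Rank E k) (T : Rank E l) :
    inj F S ≫ (complex F).d k l ≫ proj F T = entry F k l S T := by
  subst h
  have h1 : (complex F).d k (k + 1) = differential F k := CochainComplex.of_d _ _ _
  rw [h1]
  change biproduct.ι (fun S : Rank E k => F.obj S.1) S ≫ differential F k ≫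
    biproduct.π (fun S : Rank E (k + 1) => F.obj S.1) T = _
  simp [differential]

/-- The map between cochain objects with matrix entries `contractionEntry`. It is defined for any
pair of degrees, and it vanishes unless the degree drops by one. -/
noncomputable def contraction (e : E) (k l : ℤ) : (complex F).X k ⟶ (complex F).X l :=
  (biproduct.desc fun S => biproduct.lift fun T => contractionEntry F act e S.1 T.1 :
    cochain F k ⟶ cochain F l)

lemma inj_contraction_proj (e : E) {k l : ℤ} (S : Rank E k) (T : Rank E l) :
    inj F S ≫ contraction F act e k l ≫ proj F T = contractionEntry F act e S.1 T.1 := by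
  change biproduct.ι (fun S : Rank E k => F.obj S.1) S ≫
    (biproduct.desc fun S => biproduct.lift fun T => contractionEntry F act e S.1 T.1) ≫
    biproduct.π (fun S : Rank E l => F.obj S.1) T = _
  simp

lemma inj_comp_proj {k l m : ℤ} [Fintype (Rank E l)] (f : (complex F).X k ⟶ (complex F).X l)
    (g : (complex F).X l ⟶ (complex F).X m) (S : Rank E k) (T : Rank E m) :
    inj F S ≫ (f ≫ g) ≫ proj F T =
      ∑ U : Rank E l, (inj F S ≫ f ≫ proj F U) ≫ (inj F U ≫ g ≫ proj F T) := by
  have h : f ≫ g = ∑ U : Rank E l, f ≫ proj F U ≫ inj F U ≫ g := by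
    rw [← Preadditive.comp_sum]
    simp only [← Category.assoc (proj F _)]
    rw [← Preadditive.sum_comp, sum_proj_inj, Category.id_comp]
  rw [h]
  simp only [Preadditive.comp_sum, Preadditive.sum_comp, Category.assoc]

/-- The chain endomorphism `1 - (δ h + h δ)`, where `h` is the contraction attached to `e`. -/
noncomputable def sweep (e : E) : complex F ⟶ complex F :=
  𝟙 _ - Homotopy.nullHomotopicMap' fun k l _ => contraction F act e k l

lemma homologyMap_sweep (e : E) (i : ℤ) :
    HomologicalComplex.homologyMap (sweep F act e) i = 𝟙 _ := by
  rw [sweep, HomologicalComplex.homologyMap_sub, HomologicalComplex.homologyMap_id,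
    (Homotopy.nullHomotopy' _).homologyMap_eq, HomologicalComplex.homologyMap_zero, sub_zero]

section Fintype

variable [∀ k : ℤ, Fintype (Rank E k)]

lemma inj_sweep_proj (e : E) (i : ℤ) (S T : Rank E i) :
    inj F S ≫ (sweep F act e).f i ≫ proj F T = inj F S ≫ proj F T -
      (∑ U : Rank E (i + 1), entry F i (i + 1) S U ≫ contractionEntry F act e U.1 T.1 +
        ∑ U : Rank E (i - 1),
          contractionEntry F act e S.1 U.1 ≫ entry F (i - 1) i U T) := by
  have h1 : (ComplexShape.up ℤ).Rel i (i + 1) := rfl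
  have h0 : (ComplexShape.up ℤ).Rel (i - 1) i := sub_add_cancel i 1
  rw [sweep, HomologicalComplex.sub_f_apply, Homotopy.nullHomotopicMap'_f h0 h1,
    Preadditive.sub_comp, Preadditive.comp_sub, HomologicalComplex.id_f, Category.id_comp,
    Preadditive.add_comp, Preadditive.comp_add, inj_comp_proj, inj_comp_proj]
  simp only [inj_d_proj F h1, inj_d_proj F h0, inj_contraction_proj]

/-- The endomorphism attached to `e` sends a summand for which some `e' < e` is active to summands
for which `e'` is active: it passes from `S` only to sets that contain all elements of `S` other
than `e`. -/
lemma inj_sweep_proj_eq_zero_of_active_lt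
    (hact : ∀ e S T, (∀ f ∈ S, f < e → f ∈ T) → act e S → act e T)
    {e e' : E} (he : e' < e) {i : ℤ} {S T : Rank E i} (hS : act e' S.1) (hT : ¬ act e' T.1) :
    inj F S ≫ (sweep F act e).f i ≫ proj F T = 0 := by
  have hST : S ≠ T := by rintro rfl; exact hT hS
  have hne : ¬ ∀ f ∈ S.1, f < e' → f ∈ T.1 := fun h => hT (hact _ _ _ h hS)
  rw [inj_sweep_proj, inj_proj_ne F hST, Finset.sum_eq_zero, Finset.sum_eq_zero, add_zero,
    sub_zero]
  · intro U _
    by_cases h : e ∉ U.1 ∧ insert e U.1 = S.1 ∧ act e U.1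
    · rw [entry_eq_zero, comp_zero]
      intro hUT
      refine hne fun f hf hfe => hUT ?_
      rw [← h.2.1] at hf
      exact Finset.mem_of_mem_insert_of_ne hf (hfe.trans he).ne
    · rw [contractionEntry_eq_zero F act h, zero_comp]
  · intro U _
    by_cases h : e ∉ T.1 ∧ insert e T.1 = U.1 ∧ act e T.1
    · rw [entry_eq_zero, zero_comp]
      intro hSU
      refine hne fun f hf hfe => ?_
      have := hSU hf
      rw [← h.2.1] at this
      exact Finset.mem_of_mem_insert_of_ne this (hfe.trans he).ne
    · rw [contractionEntry_eq_zero F act h, comp_zero]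

/-- The endomorphism attached to `e` vanishes on the summands for which `e` is active. The diagonal
entry is `1 - 1`, and an entry from `S = U ∪ {e}` to `T = U ∪ {f}` is a sum of two terms, passing
through `U` and through `U ∪ {e, f}`, which cancel because the signs of a diamond multiply
to `-1`. -/
lemma inj_sweep_proj_eq_zero (hact : ∀ e S T, (∀ f ∈ S, f < e → f ∈ T) → act e S → act e T)
    (hiso : ∀ e S T, insert e S = T → act e S → ∀ h : S ≤ T, IsIso (F.map (homOfLE h)))
    {e : E} {i : ℤ} {S : Rank E i} (hS : act e S.1) (T : Rank E i) :
    inj F S ≫ (sweep F act e).f i ≫ proj F T = 0 := by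
  rw [inj_sweep_proj, sub_eq_zero]
  have hSc := S.2
  have hTc := T.2
  by_cases heS : e ∈ S.1
  · let U : Rank E (i - 1) := ⟨S.1.erase e, by
      rw [Finset.card_erase_of_mem heS, Nat.cast_sub (Finset.card_pos.2 ⟨e, heS⟩)]
      push_cast; omega⟩
    have hUS : insert e U.1 = S.1 := Finset.insert_erase heS
    have heU : e ∉ U.1 := Finset.notMem_erase e _
    have haU : act e U.1 := hact e _ _ (fun f hf hfe => Finset.mem_erase.2 ⟨hfe.ne, hf⟩) hS
    have h2 : ∑ U : Rank E (i - 1), contractionEntry F act e S.1 U.1 ≫ entry F (i - 1) i U T =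
        contractionEntry F act e S.1 U.1 ≫ entry F (i - 1) i U T := by
      refine Finset.sum_eq_single U (fun W _ hW => ?_) (by simp)
      rw [contractionEntry_eq_zero, zero_comp]
      rintro ⟨h3, h4, -⟩
      refine hW (Subtype.ext ?_)
      rw [← Finset.erase_insert h3, h4]
    rw [h2]
    by_cases hST : S = T
    · subst hST
      rw [inj_proj_self, contractionEntry_comp_entry_self F act heU hUS haU (hiso _ _ _ hUS haU),
        Finset.sum_eq_zero, zero_add]
      intro W _
      rw [contractionEntry_eq_zero F act (fun h => h.1 heS), comp_zero]
    rw [inj_proj_ne F hST]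
    -- An off-diagonal entry; here `U = S \ {e}`, and a nonzero term needs `U ⊆ T`.
    by_cases hUT : U.1 ≤ T.1
    · have heT : e ∉ T.1 := by
        intro heT
        refine hST (Subtype.ext (Finset.eq_of_subset_of_card_le ?_ (by omega)))
        rw [← hUS]
        exact Finset.insert_subset heT hUT
      obtain ⟨f, hfU, hfT⟩ := exists_insert (k := i - 1) (S := U)
        (T := ⟨T.1, by rw [hTc]; ring⟩) hUT
      change insert f U.1 = T.1 at hfT
      have hef : e ≠ f := by
        rintro rfl
        exact heT (hfT ▸ Finset.mem_insert_self _ _)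
      let W : Rank E (i + 1) := ⟨insert e T.1, by
        rw [Finset.card_insert_of_notMem heT]; push_cast; omega⟩
      have haT : act e T.1 := hact e _ _ (fun x hx _ => hUT hx) haU
      have hW : insert e T.1 = W.1 := rfl
      have h1 : ∑ W : Rank E (i + 1),
          entry F i (i + 1) S W ≫ contractionEntry F act e W.1 T.1 =
          entry F i (i + 1) S W ≫ contractionEntry F act e W.1 T.1 := by
        refine Finset.sum_eq_single W (fun W' _ hW' => ?_) (by simp)
        rw [contractionEntry_eq_zero, comp_zero]
        rintro ⟨-, h4, -⟩
        exact hW' (Subtype.ext h4.symm)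
      have hTW : T.1 ≤ W.1 := Finset.subset_insert _ _
      have hUS' : U.1 ≤ S.1 := Finset.erase_subset _ _
      have hSW : S.1 ≤ W.1 := hUS ▸ Finset.insert_subset_insert _ hUT
      have i1 := hiso _ _ _ hW haT hTW
      have i2 := hiso _ _ _ hUS haU hUS'
      have hcomm : F.map (homOfLE hSW) ≫ inv (F.map (homOfLE hTW)) =
          inv (F.map (homOfLE hUS')) ≫ F.map (homOfLE hUT) := by
        rw [IsIso.comp_inv_eq, Category.assoc, IsIso.eq_inv_comp, ← F.map_comp, ← F.map_comp]
        rfl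
      have hdiamond : sign U.1 S.1 * sign S.1 W.1 + sign U.1 T.1 * sign T.1 W.1 = 0 := by
        rw [← hW, ← hUS, ← hfT, Finset.insert_comm e f]
        exact sign_diamond heU hfU hef
      rw [h1, entry_eq F hSW, entry_eq F hUT, contractionEntry_eq F act hTW heT hW haT,
        contractionEntry_eq F act hUS' heU hUS haU]
      simp only [Preadditive.zsmul_comp, Preadditive.comp_zsmul, smul_smul]
      rw [hcomm, ← add_smul]
      have hsign : sign S.1 W.1 * sign T.1 W.1 + sign U.1 T.1 * sign U.1 S.1 = 0 := by
        linear_combination (sign U.1 S.1 * sign T.1 W.1) * hdiamond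
          - sign S.1 W.1 * sign T.1 W.1 * sign_mul_self U.1 S.1
          - sign U.1 T.1 * sign U.1 S.1 * sign_mul_self T.1 W.1
      rw [mul_comm (sign T.1 W.1), hsign, zero_smul]
    · rw [entry_eq_zero F hUT, comp_zero, add_zero, eq_comm]
      refine Finset.sum_eq_zero fun W _ => ?_
      by_cases h : e ∉ T.1 ∧ insert e T.1 = W.1 ∧ act e T.1
      · rw [entry_eq_zero, zero_comp]
        intro hSW
        refine hUT fun x hx => ?_
        have hx' := hSW (Finset.mem_of_mem_erase hx)
        rw [← h.2.1] at hx'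
        exact Finset.mem_of_mem_insert_of_ne hx' (Finset.ne_of_mem_erase hx)
      · rw [contractionEntry_eq_zero F act h, comp_zero]
  · have h2 : ∑ U : Rank E (i - 1),
        contractionEntry F act e S.1 U.1 ≫ entry F (i - 1) i U T = 0 := by
      refine Finset.sum_eq_zero fun U _ => ?_
      rw [contractionEntry_eq_zero, zero_comp]
      rintro ⟨-, h, -⟩
      exact heS (h ▸ Finset.mem_insert_self _ _)
    rw [h2, add_zero]
    let W : Rank E (i + 1) := ⟨insert e S.1, by
      rw [Finset.card_insert_of_notMem heS]; push_cast; omega⟩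
    by_cases hST : S = T
    · subst hST
      rw [inj_proj_self, Finset.sum_eq_single W,
        entry_comp_contractionEntry_self F act heS rfl hS (hiso _ _ _ rfl hS)]
      · intro W' _ hW'
        rw [contractionEntry_eq_zero, comp_zero]
        rintro ⟨-, h, -⟩
        exact hW' (Subtype.ext h.symm)
      · simp
    · rw [inj_proj_ne F hST, eq_comm]
      refine Finset.sum_eq_zero fun U _ => ?_
      by_cases h : e ∉ T.1 ∧ insert e T.1 = U.1 ∧ act e T.1
      · rw [entry_eq_zero, zero_comp]
        intro hSU
        refine hST (Subtype.ext (Finset.eq_of_subset_of_card_le (fun x hx => ?_) (by omega)))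
        have hx' := hSU hx
        rw [← h.2.1] at hx'
        exact Finset.mem_of_mem_insert_of_ne hx' fun hxe => heS (hxe ▸ hx)
      · rw [contractionEntry_eq_zero F act h, comp_zero]

end Fintype

/-- Let `act e T` be a property of pairs that depends only on the elements of `T` below `e` and is
monotone in them, and suppose that `F(T ⋖ T ∪ {e})` is invertible whenever it holds. If it holds
for some `e` for every `T` of rank `i`, then the cohomology of `C^*(F)` in degree `i` vanishes. -/
theorem isZero_homology_complex
    (hact : ∀ e S T, (∀ f ∈ S, f < e → f ∈ T) → act e S → act e T)
    (hiso : ∀ e S T, insert e S = T → act e S → ∀ h : S ≤ T, IsIso (F.map (homOfLE h)))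
    (i : ℤ) (hi : ∀ S : Rank E i, ∃ e, act e S.1) : IsZero ((complex F).homology i) := by
  have := fun k : ℤ => Fintype.ofFinite (Rank E k)
  have := Fintype.ofFinite E
  let r := (Fintype.orderIsoFinOfCardEq E rfl).symm
  -- Composing the endomorphisms `sweep` from the largest `e` down keeps the induced map on
  -- cohomology the identity, and after each step the image in degree `i` meets only summands with
  -- an active element below those already used; `r` numbers the elements of `E` in order.
  have key : ∀ k ≤ Fintype.card E, ∃ φ : complex F ⟶ complex F,
      HomologicalComplex.homologyMap φ i = 𝟙 _ ∧
        ∀ T : Rank E i, (∀ e, act e T.1 → k ≤ (r e : ℕ)) → φ.f i ≫ proj F T = 0 := by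
    intro k hk
    induction hk using Nat.decreasingInduction with
    | self =>
      refine ⟨𝟙 _, HomologicalComplex.homologyMap_id _ _, fun T hT => ?_⟩
      obtain ⟨e, he⟩ := hi T
      exact absurd (hT e he) (r e).2.not_ge
    | of_succ k hk ih =>
      obtain ⟨φ, hφ, hφ0⟩ := ih
      let a : E := r.symm ⟨k, hk⟩
      have hra : (r a : ℕ) = k := by simp [a]
      refine ⟨φ ≫ sweep F act a, ?_, fun T hT => ?_⟩
      · rw [HomologicalComplex.homologyMap_comp, hφ, homologyMap_sweep, Category.comp_id]
      · rw [HomologicalComplex.comp_f, Category.assoc, ← Category.id_comp ((sweep F act a).f i ≫ _),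
          ← sum_proj_inj F i, Preadditive.sum_comp, Preadditive.comp_sum]
        refine Finset.sum_eq_zero fun S _ => ?_
        by_cases hS : ∀ e, act e S.1 → k + 1 ≤ (r e : ℕ)
        · rw [Category.assoc, reassoc_of% (hφ0 S hS), zero_comp]
        push Not at hS
        obtain ⟨e, he, hek⟩ := hS
        rw [Category.assoc]
        rcases (Nat.lt_succ_iff.1 hek).lt_or_eq with h | h
        · have hea : e < a := r.lt_iff_lt.1 (by rw [Fin.lt_def, hra]; exact h)
          rw [inj_sweep_proj_eq_zero_of_active_lt F act hact hea he
            fun h' => absurd (hT e h') h.not_ge, comp_zero, comp_zero]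
        · have hea : e = a := r.injective (Fin.ext (h.trans hra.symm))
          rw [inj_sweep_proj_eq_zero F act hact hiso (hea ▸ he), comp_zero, comp_zero]
  obtain ⟨φ, hφ, hφ0⟩ := key 0 (Nat.zero_le _)
  have h0 : φ.f i = 0 := hom_ext_proj F fun T => by
    rw [hφ0 T fun _ _ => Nat.zero_le _, zero_comp]
  rw [IsZero.iff_id_eq_zero, ← hφ, ← cancel_epi ((complex F).homologyπ i),
    HomologicalComplex.homologyπ_naturality, comp_zero]
  have : HomologicalComplex.cyclesMap φ i = 0 := by
    rw [← cancel_mono ((complex F).iCycles i), HomologicalComplex.cyclesMap_i, h0, comp_zero,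
      zero_comp]
  rw [this, zero_comp]

end Contraction

lemma isZero_homology_complex_of_isZero {E : Type u} [LinearOrder E] [Finite E] {A : Type v}
    [Category.{w} A] [Abelian A] (F : Finset E ⥤ A) (i : ℤ)
    (h : ∀ S : Rank E i, IsZero (F.obj S.1)) : IsZero ((complex F).homology i) := by
  rw [← HomologicalComplex.exactAt_iff_isZero_homology]
  refine ShortComplex.exact_of_isZero_X₂ _ ?_
  refine (IsZero.iff_id_eq_zero _).2 (hom_ext_proj F fun S => (h S).eq_of_tgt _ _)

end BooleanLattice

namespace ChromaticSymmetric

/-! ### Induced representations and exterior powers -/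

lemma indHom_isIso {H : Type u} [Group H] {Y Y' : Subgroup H} {L L' : Type u} [AddCommGroup L]
    [Module ℂ L] [AddCommGroup L'] [Module ℂ L'] (ρ : Representation ℂ Y L)
    (ρ' : Representation ℂ Y' L') (hY : Y ≤ Y') (f : L →ₗ[ℂ] L')
    (hf : ∀ (y : Y) (x : L), f (ρ y x) = ρ' (Subgroup.inclusion hY y) (f x))
    (h : Y = Y') (hbij : Function.Bijective f) : IsIso (indHom ρ ρ' hY f hf) := by
  subst h
  let f' := (LinearEquiv.ofBijective f hbij).symm
  have hf' : ∀ (y : Y) (x : L'), f'.toLinearMap (ρ' y x) =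
      ρ (Subgroup.inclusion hY y) (f'.toLinearMap x) := by
    intro y x
    apply hbij.1
    have h1 : ∀ z, f (f'.toLinearMap z) = z := (LinearEquiv.ofBijective f hbij).apply_symm_apply
    rw [hf, h1, h1]
    rfl
  refine ⟨indHom ρ' ρ hY f'.toLinearMap hf', ?_, ?_⟩
  · rw [← indHom_comp ρ ρ' ρ hY hY hY f f'.toLinearMap LinearMap.id hf hf' (fun _ _ => rfl)]
    · exact indHom_id ρ hY _ _ rfl
    · ext x; exact ((LinearEquiv.ofBijective f hbij).symm_apply_apply x).symm
  · rw [← indHom_comp ρ' ρ ρ' hY hY hY f'.toLinearMap f LinearMap.id hf' hf (fun _ _ => rfl)]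
    · exact indHom_id ρ' hY _ _ rfl
    · ext x; exact ((LinearEquiv.ofBijective f hbij).apply_symm_apply x).symm

/-- A representation induced from a zero representation is zero. -/
lemma isZero_ind {H : Type u} [Group H] {Y : Subgroup H} {L : Type u} [AddCommGroup L]
    [Module ℂ L] [Subsingleton L] (ρ : Representation ℂ Y L) :
    IsZero (Rep.of (ρ.ind Y.subtype)) := by
  have h : (LinearMap.id : Representation.IndV Y.subtype ρ →ₗ[ℂ] _) = 0 :=
    Representation.IndV.hom_ext _ _ fun h => LinearMap.ext fun x => by
      rw [Subsingleton.elim x 0]; simp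
  rw [Rep.isZero_iff]
  exact subsingleton_of_forall_eq (0 : Representation.IndV Y.subtype ρ)
    fun x => LinearMap.congr_fun h x

lemma extMap_inclusion_bijective {U : Type u} [AddCommGroup U] [Module ℂ U] {p q : Submodule ℂ U}
    (h : p ≤ q) (hpq : p = q) (j : ℤ) :
    Function.Bijective (extMap (Submodule.inclusion h) j) := by
  subst hpq
  rw [extMap_inclusion_refl]
  exact Function.bijective_id

lemma subsingleton_extPart {U : Type u} [AddCommGroup U] [Module ℂ U] [Module.Finite ℂ U] {j : ℤ}
    (hj : j < 0 ∨ (Module.finrank ℂ U : ℤ) < j) : Subsingleton (extPart U j) := by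
  unfold extPart
  split_ifs with h
  · have h1 : Module.finrank ℂ (⋀[ℂ]^j.toNat U) = 0 := by
      rw [exteriorPower.finrank_eq, Nat.choose_eq_zero_iff]
      omega
    exact Module.finrank_zero_iff.1 h1
  · infer_instance

/-! ### Active elements of a family of vectors -/

section Active

variable {E W : Type*} [LinearOrder E] [AddCommGroup W] [Module ℂ W] {x : E → W}

/-- For a family of vectors `x` indexed by a linearly ordered set, the index `e` is active for the
finite set `T` if `x e` is a linear combination of the `x f` with `f ∈ T` and `f < e`. It is not
required that `e ∉ T` or `e ∈ T`, so adding or removing `e` does not change whether `e` is active.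
For the edge vectors of a graph, a set of edges has an active edge exactly if it contains a broken
circuit (a cycle with its largest edge removed). -/
def IsActive (x : E → W) (e : E) (T : Finset E) : Prop :=
  x e ∈ Submodule.span ℂ (x '' {f | f ∈ T ∧ f < e})

lemma IsActive.mono {e : E} {S T : Finset E} (h : ∀ f ∈ S, f < e → f ∈ T)
    (hS : IsActive x e S) : IsActive x e T :=
  Submodule.span_mono (Set.image_mono fun f (hf : f ∈ S ∧ f < e) =>
    (⟨h f hf.1 hf.2, hf.2⟩ : f ∈ T ∧ f < e)) hS

lemma IsActive.span_insert {e : E} {T : Finset E} (h : IsActive x e T) :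
    Submodule.span ℂ (x '' T) = Submodule.span ℂ (x '' (insert e T : Finset E)) := by
  rw [Finset.coe_insert, Set.image_insert_eq, eq_comm]
  exact Submodule.span_insert_eq_span (Submodule.span_mono (Set.image_mono fun g hg => hg.1) h)

/-- In a nontrivial linear relation among the `x f` with `f ∈ S`, the largest index with a nonzero
coefficient is active for `S`. -/
lemma linearIndepOn_of_not_isActive {S : Finset E} (h : ∀ e, ¬ IsActive x e S) :
    LinearIndepOn ℂ x (S : Set E) := by
  induction S using Finset.induction_on_max with
  | empty => simp
  | insert a s ha ih =>
    rw [Finset.coe_insert, linearIndepOn_insert fun h' => (ha a h').ne rfl]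
    refine ⟨ih fun e he => h e (he.mono fun f hf _ => Finset.mem_insert_of_mem hf), fun h' => ?_⟩
    exact h a (Submodule.span_mono
      (Set.image_mono fun f hf =>
      (⟨Finset.mem_insert_of_mem hf, ha f hf⟩ : f ∈ insert a s ∧ f < a)) h')

end Active

/-! ### Edge vectors of a graph -/

section Graph

variable {V : Type u} (G : SimpleGraph V)

/-- The difference of the indicator vectors of the two endpoints of an edge. The orientation of the
edge is an arbitrary choice. -/
noncomputable def edgeVector (e : G.edgeSet) : V → ℂ :=
  open scoped Classical in
  Pi.single (Quot.out e.1).1 1 - Pi.single (Quot.out e.1).2 1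

/-- The span of the edge vectors of a set of edges. -/
noncomputable def edgeSpan (T : Set G.edgeSet) : Submodule ℂ (V → ℂ) :=
  Submodule.span ℂ (edgeVector G '' T)

lemma mk_out (e : G.edgeSet) : s((Quot.out e.1).1, (Quot.out e.1).2) = e.1 := Quot.out_eq e.1

lemma spanning_adj_out {T : Finset G.edgeSet} {e : G.edgeSet} (he : e ∈ T) :
    (spanning G T).Adj (Quot.out e.1).1 (Quot.out e.1).2 := by
  rw [spanning, SimpleGraph.fromEdgeSet_adj, mk_out]
  refine ⟨⟨e, he, rfl⟩, ?_⟩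
  have := e.2
  rw [← mk_out, SimpleGraph.mem_edgeSet] at this
  exact this.ne

open scoped Classical in
lemma single_sub_single_mem_of_adj {T : Finset G.edgeSet} {a b : V} (h : (spanning G T).Adj a b) :
    (Pi.single a 1 - Pi.single b 1 : V → ℂ) ∈ edgeSpan G T := by
  rw [spanning, SimpleGraph.fromEdgeSet_adj] at h
  obtain ⟨⟨e, he, hab⟩, -⟩ := h
  have hmem : edgeVector G e ∈ edgeSpan G T := Submodule.subset_span ⟨e, he, rfl⟩
  rw [← mk_out, Sym2.eq_iff] at hab
  rcases hab with ⟨rfl, rfl⟩ | ⟨rfl, rfl⟩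
  · exact hmem
  · have := neg_mem hmem
    rwa [edgeVector, neg_sub] at this

variable [Fintype V]

open scoped Classical in
lemma reachable_iff_single_sub_single_mem (T : Finset G.edgeSet) (a b : V) :
    (spanning G T).Reachable a b ↔ (Pi.single a 1 - Pi.single b 1 : V → ℂ) ∈ edgeSpan G T := by
  constructor
  · rintro ⟨p⟩
    induction p with
    | nil => simp
    | @cons a b c h _ ih =>
      have := add_mem (single_sub_single_mem_of_adj G h) ih
      rwa [sub_add_sub_cancel] at this
  · intro h
    -- The sum of the coordinates over the component of `a` vanishes on all edge vectors of `T`.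
    let φ : (V → ℂ) →ₗ[ℂ] ℂ :=
      ∑ v : V, (if (spanning G T).Reachable a v then (1 : ℂ) else 0) • LinearMap.proj v
    have hφ : ∀ v, φ (Pi.single v 1) = if (spanning G T).Reachable a v then (1 : ℂ) else 0 := by
      intro v
      simp only [φ, LinearMap.sum_apply, LinearMap.smul_apply, LinearMap.proj_apply, smul_eq_mul]
      rw [Finset.sum_eq_single v (fun w _ hw => by simp [Pi.single_eq_of_ne hw]) (by simp)]
      simp
    have hle : edgeSpan G T ≤ LinearMap.ker φ := by
      refine Submodule.span_le.2 ?_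
      rintro _ ⟨e, he, rfl⟩
      have hadj := (spanning_adj_out G he).reachable
      have : (spanning G T).Reachable a (Quot.out e.1).1 ↔
          (spanning G T).Reachable a (Quot.out e.1).2 :=
        ⟨fun h => h.trans hadj, fun h => h.trans hadj.symm⟩
      rw [SetLike.mem_coe, LinearMap.mem_ker, edgeVector, map_sub, hφ, hφ, sub_eq_zero]
      simp only [this]
    have h0 := LinearMap.mem_ker.1 (hle h)
    rw [map_sub, hφ, hφ, if_pos (SimpleGraph.Reachable.refl a)] at h0
    by_contra hab
    rw [if_neg hab] at h0
    simp at h0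

lemma stdSum_eq_edgeSpan (T : Finset G.edgeSet) : stdSum G T = edgeSpan G T := by
  classical
  apply le_antisymm
  · refine iSup_le fun C => ?_
    rintro x ⟨hx, hx'⟩
    obtain ⟨c, hc⟩ := C.nonempty_supp
    have hsum : x = ∑ v, x v • (Pi.single v 1 - Pi.single c 1 : V → ℂ) := by
      simp only [smul_sub]
      rw [Finset.sum_sub_distrib, ← Finset.sum_smul, hx', zero_smul, sub_zero]
      exact pi_eq_sum_univ' x
    rw [hsum]
    refine sum_mem fun v _ => ?_
    by_cases hv : v ∈ C.supp
    · refine Submodule.smul_mem _ _ ((reachable_iff_single_sub_single_mem G T v c).1 ?_)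
      rw [SimpleGraph.ConnectedComponent.mem_supp_iff] at hv hc
      exact SimpleGraph.ConnectedComponent.exact (hv.trans hc.symm)
    · rw [hx v hv, zero_smul]
      exact zero_mem _
  · refine Submodule.span_le.2 ?_
    rintro _ ⟨e, he, rfl⟩
    have hadj := (spanning_adj_out G he).reachable
    refine Submodule.mem_iSup_of_mem
      ((spanning G T).connectedComponentMk (Quot.out e.1).1) ⟨fun v hv => ?_, ?_⟩
    · have h1 : v ≠ (Quot.out e.1).1 := by
        rintro rfl
        exact hv rfl
      have h2 : v ≠ (Quot.out e.1).2 := by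
        rintro rfl
        exact hv (SimpleGraph.ConnectedComponent.sound hadj.symm)
      simp [edgeVector, h1, h2]
    · simp [edgeVector, Finset.sum_sub_distrib]

lemma finrank_stdSum_le (T : Finset G.edgeSet) : Module.finrank ℂ (stdSum G T) ≤ T.card := by
  classical
  rw [stdSum_eq_edgeSpan, edgeSpan, ← Finset.coe_image]
  exact (finrank_span_finset_le_card _).trans Finset.card_image_le

/-- Two sets of edges `T ⊆ T'` with the same span have the same connected components, and then
`M_T → M_{T'}` is an isomorphism. -/
lemma isIso_MMap {T T' : Finset G.edgeSet} (h : T ≤ T') (hT : edgeSpan G T = edgeSpan G T')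
    (j : ℤ) : IsIso (MMap G h j) := by
  classical
  refine indHom_isIso _ _ _ _ _ ?_ (extMap_inclusion_bijective _ ?_ j)
  · ext σ
    refine forall_congr' fun v => ?_
    rw [SimpleGraph.ConnectedComponent.eq, SimpleGraph.ConnectedComponent.eq,
      reachable_iff_single_sub_single_mem, reachable_iff_single_sub_single_mem, hT]
  · rw [stdSum_eq_edgeSpan, stdSum_eq_edgeSpan, hT]

/-- The sum of the `S^{(b_m-1,1)}` has dimension at most `#T`, so its exterior powers vanish in
degrees above `#T`. -/
lemma isZero_M {T : Finset G.edgeSet} {j : ℤ} (hj : j < 0 ∨ (T.card : ℤ) < j) :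
    IsZero (M G T j) := by
  have : Subsingleton (extPart (stdSum G T) j) :=
    subsingleton_extPart (hj.imp_right fun h => by have := finrank_stdSum_le G T; omega)
  exact isZero_ind _

/-- All edge vectors have coordinate sum zero. -/
lemma edgeSpan_ne_top [Nonempty V] (T : Set G.edgeSet) : edgeSpan G T ≠ ⊤ := by
  classical
  intro h
  let φ : (V → ℂ) →ₗ[ℂ] ℂ := ∑ v : V, LinearMap.proj v
  have hle : edgeSpan G T ≤ LinearMap.ker φ := by
    refine Submodule.span_le.2 ?_
    rintro _ ⟨e, -, rfl⟩
    simp [φ, edgeVector, Finset.sum_sub_distrib]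
  have h1 : (Pi.single (Classical.arbitrary V) 1 : V → ℂ) ∈ LinearMap.ker φ :=
    hle (h ▸ Submodule.mem_top)
  simp [φ] at h1

/-- The edge vectors span a proper subspace of `ℂ^V`, so `#V` of them are linearly dependent. -/
lemma exists_isActive [LinearOrder G.edgeSet] [Nonempty V] {S : Finset G.edgeSet}
    (hS : Fintype.card V ≤ S.card) : ∃ e, IsActive (edgeVector G) e S := by
  by_contra! h
  have h1 : Module.finrank ℂ (edgeSpan G (S : Set G.edgeSet)) = S.card := by
    have := finrank_span_eq_card (linearIndepOn_of_not_isActive h)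
    rw [← Set.image_eq_range] at this
    rw [edgeSpan, this]
    simp
  have h2 := Submodule.finrank_lt (edgeSpan_ne_top G (S : Set G.edgeSet))
  rw [h1, Module.finrank_fintype_fun_eq_card] at h2
  omega

end Graph

end ChromaticSymmetric

theorem mainTheorem6 {V : Type u} [Fintype V] (G : SimpleGraph V) [LinearOrder G.edgeSet]
    (hG : G.Connected) (i j : ℤ) (h : ¬ IsZero (ChromaticSymmetric.HCS G i j)) :
    (0 ≤ i ∧ i ≤ (Fintype.card V : ℤ) - 1) ∧ (0 ≤ j ∧ j ≤ i) := by
  have := hG.nonempty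
  have hi0 : 0 ≤ i := by
    by_contra hi
    exact h (BooleanLattice.isZero_homology_complex_of_isZero _ _
      fun S => absurd S.2 (by omega))
  have hj : 0 ≤ j ∧ j ≤ i := by
    by_contra hj
    refine h (BooleanLattice.isZero_homology_complex_of_isZero _ _ fun S => ?_)
    refine ChromaticSymmetric.isZero_M G ?_
    rw [S.2]
    omega
  refine ⟨⟨hi0, ?_⟩, hj⟩
  by_contra hi
  refine h (BooleanLattice.isZero_homology_complex _
    (ChromaticSymmetric.IsActive (ChromaticSymmetric.edgeVector G))
    (fun e S T hST hS => hS.mono hST) ?_ i fun S => ?_)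
  · rintro e S _ rfl he hle
    exact ChromaticSymmetric.isIso_MMap G hle he.span_insert j
  · refine ChromaticSymmetric.exists_isActive G ?_
    have := S.2
    omega
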